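/- Let $\mathcal A$ be a nonempty finite alphabet, $\Omega=\mathcal A^{\mathbb N}$ (with $\mathbb N=\{0,1,2,\dots\}$) the one-sided full shift with the product topology, and $T:\Omega\to\Omega$, $(Tx)_n=x_{n+1}$, the shift map. Let $A=(A_n)_{n\ge 0}$ be a decreasing sequence of positive reals with $A_n\to 0$ and $A_{n+1}/A_n\to 0$. Let $d_A$ be the metric on $\Omega$ with $d_A(x,y)=A_n$ if $x_i=y_i$ for $0\le i<n$ and $x_n\ne y_n$ (and $d_A(x,x)=0$). Let $C_A(\Omega)$ be the space of functions $f:\Omega\to\mathbb R$ that are Lipschitz with respect to $d_A$, with the norm $$\|f\|_A=\sup_{k\ge 0}\frac{\mathrm{var}_k(f)}{A_k}+\sup_{x\in\Omega}|f(x)|,\qquad \mathrm{var}_k(f)=\sup\{|f(x)-f(y)| : x_i=y_i \text{ for all } 0\le i<k\}.$$ A $T$-invariant Borel probability measure $\mu$ on $\Omega$ is called maximizing for $f$ if $\int f\,d\nu\le\int f\,d\mu$ for every $T$-invariant Borel probability measure $\nu$. For a periodic point $y$ of $T$ with least period $p\ge 1$, let $\mu_y=\frac1p\sum_{i=0}^{p-1}\delta_{T^iy}$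 be the $T$-invariant probability measure on the orbit of $y$, and let $$P_y=\{f\in C_A(\Omega) : \mu_y \text{ is the unique maximizing measure for } f\}.$$ Then $C_A(\Omega)$ is a Banach space, it is non-separable if $\mathcal A$ has at least two letters, and $$\bigcup_{y\ \text{periodic}} (P_y)^\circ$$ is dense in $C_A(\Omega)$, where $(P_y)^\circ$ denotes the interior of $P_y$ in the $A$-norm topology. -/

import Mathlib

open MeasureTheory Filter Topology

namespace SuperCont

/-- An `A`-sequence: a decreasing sequence of positive reals tending to `0`. -/
structure ASequence where
  /-- the terms of the sequence -/
  val : ℕ → ℝ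
  pos : ∀ n, 0 < val n
  anti : Antitone val
  tendsto_zero : Tendsto val atTop (𝓝 0)

/-- The left shift on the one-sided sequence space `ℕ → α`. -/
def shift {α : Type*} (x : ℕ → α) : ℕ → α := fun n => x (n + 1)

open Classical in
/-- The metric `d_A`: `A n` if `x` and `y` first differ at place `n`, and `0` if `x = y`. -/
noncomputable def dA {α : Type*} (A : ASequence) (x y : ℕ → α) : ℝ :=
  if x = y then 0 else A.val (PiNat.firstDiff x y)

/-- `f` is Lipschitz with respect to `d_A`. -/
def IsLipA {α : Type*} (A : ASequence) (f : (ℕ → α) → ℝ) : Prop :=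
  ∃ L : ℝ, ∀ x y, |f x - f y| ≤ L * dA A x y

/-- The `k`-th variation `sup {|f x - f y| : d(x, y) ≤ 2⁻ᵏ}` of `f`; in the standard metric `d`,
`d(x, y) ≤ 2⁻ᵏ` says that `x` and `y` have the same first `k` symbols. -/
noncomputable def variation {α : Type*} (f : (ℕ → α) → ℝ) (k : ℕ) : ℝ :=
  sSup {r | ∃ x y : ℕ → α, (∀ i < k, x i = y i) ∧ r = |f x - f y|}

/-- `Lip_A(f) = sup_k var_k(f) / A_k`. -/
noncomputable def lipConst {α : Type*} (A : ASequence) (f : (ℕ → α) → ℝ) : ℝ :=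
  ⨆ k, variation f k / A.val k

/-- The supremum norm. -/
noncomputable def supNorm {α : Type*} (f : (ℕ → α) → ℝ) : ℝ := ⨆ x, |f x|

section Helpers

variable {α : Type*} {A : ASequence} {f g : (ℕ → α) → ℝ}

theorem dA_nonneg (x y : ℕ → α) : 0 ≤ dA A x y := by
  unfold dA
  split_ifs
  · exact le_rfl
  · exact (A.pos _).le

theorem dA_le {x y : ℕ → α} {k : ℕ} (h : ∀ i < k, x i = y i) : dA A x y ≤ A.val k := by
  unfold dA
  split_ifs with hxy
  · exact (A.pos _).le
  · apply A.anti
    by_contra hlt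
    exact PiNat.apply_firstDiff_ne hxy (h _ (not_le.mp hlt))

theorem IsLipA.exists_nonneg (hf : IsLipA A f) :
    ∃ L : ℝ, 0 ≤ L ∧ ∀ x y, |f x - f y| ≤ L * dA A x y := by
  obtain ⟨L, hL⟩ := hf
  exact ⟨max L 0, le_max_right _ _, fun x y => (hL x y).trans
    (mul_le_mul_of_nonneg_right (le_max_left _ _) (dA_nonneg x y))⟩

theorem IsLipA.exists_bound (hf : IsLipA A f) : ∃ L : ℝ, 0 ≤ L ∧
    ∀ (k : ℕ) (x y : ℕ → α), (∀ i < k, x i = y i) → |f x - f y| ≤ L * A.val k := by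
  obtain ⟨L, h0, hL⟩ := hf.exists_nonneg
  exact ⟨L, h0, fun k x y h => (hL x y).trans (mul_le_mul_of_nonneg_left (dA_le h) h0)⟩

theorem IsLipA.abs_sub_le_variation (hf : IsLipA A f) {k : ℕ} {x y : ℕ → α}
    (h : ∀ i < k, x i = y i) : |f x - f y| ≤ variation f k := by
  obtain ⟨L, _, hL⟩ := hf.exists_bound
  refine le_csSup ⟨L * A.val k, ?_⟩ ⟨x, y, h, rfl⟩
  rintro _ ⟨x, y, h, rfl⟩
  exact hL k x y h

theorem variation_le {k : ℕ} {c : ℝ} (hc : 0 ≤ c)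
    (h : ∀ x y : ℕ → α, (∀ i < k, x i = y i) → |f x - f y| ≤ c) : variation f k ≤ c := by
  refine Real.sSup_le ?_ hc
  rintro _ ⟨x, y, hxy, rfl⟩
  exact h x y hxy

theorem variation_nonneg (k : ℕ) : 0 ≤ variation f k := by
  refine Real.sSup_nonneg ?_
  rintro _ ⟨x, y, -, rfl⟩
  exact abs_nonneg _

theorem IsLipA.variation_div_le (hf : IsLipA A f) (k : ℕ) :
    variation f k / A.val k ≤ lipConst A f := by
  obtain ⟨L, h0, hL⟩ := hf.exists_bound
  refine le_ciSup (f := fun k => variation f k / A.val k) ⟨L, ?_⟩ k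
  rintro _ ⟨j, rfl⟩
  exact (div_le_iff₀ (A.pos j)).2
    (variation_le (mul_nonneg h0 (A.pos j).le) (hL j))

theorem lipConst_nonneg : 0 ≤ lipConst A f :=
  Real.iSup_nonneg fun k => div_nonneg (variation_nonneg k) (A.pos k).le

theorem IsLipA.abs_sub_le (hf : IsLipA A f) {k : ℕ} {x y : ℕ → α}
    (h : ∀ i < k, x i = y i) : |f x - f y| ≤ lipConst A f * A.val k :=
  (hf.abs_sub_le_variation h).trans ((div_le_iff₀ (A.pos k)).1 (hf.variation_div_le k))

theorem lipConst_le {c : ℝ} (hc : 0 ≤ c)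
    (h : ∀ (k : ℕ) (x y : ℕ → α), (∀ i < k, x i = y i) → |f x - f y| ≤ c * A.val k) :
    lipConst A f ≤ c :=
  Real.iSup_le (fun k => (div_le_iff₀ (A.pos k)).2
    (variation_le (mul_nonneg hc (A.pos k).le) (h k))) hc

theorem supNorm_nonneg : 0 ≤ supNorm f := Real.iSup_nonneg fun _ => abs_nonneg _

theorem IsLipA.abs_le_supNorm (hf : IsLipA A f) (x : ℕ → α) : |f x| ≤ supNorm f := by
  obtain ⟨L, _, hL⟩ := hf.exists_bound
  refine le_ciSup (f := fun x => |f x|) ⟨|f x| + L * A.val 0, ?_⟩ x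
  rintro _ ⟨y, rfl⟩
  have h1 := hL 0 y x (fun i hi => absurd hi (Nat.not_lt_zero i))
  have h2 := abs_sub_abs_le_abs_sub (f y) (f x)
  simp only
  linarith

theorem IsLipA.add (hf : IsLipA A f) (hg : IsLipA A g) : IsLipA A (f + g) := by
  obtain ⟨L, hL⟩ := hf
  obtain ⟨M, hM⟩ := hg
  refine ⟨L + M, fun x y => ?_⟩
  have h := abs_add_le (f x - f y) (g x - g y)
  have e : (f + g) x - (f + g) y = (f x - f y) + (g x - g y) := by
    simp only [Pi.add_apply]; ring
  rw [e, add_mul]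
  linarith [hL x y, hM x y]

theorem IsLipA.smul (c : ℝ) (hf : IsLipA A f) : IsLipA A (c • f) := by
  obtain ⟨L, hL⟩ := hf
  refine ⟨|c| * L, fun x y => ?_⟩
  have e : (c • f) x - (c • f) y = c * (f x - f y) := by
    simp only [Pi.smul_apply, smul_eq_mul]; ring
  rw [e, abs_mul, mul_assoc]
  exact mul_le_mul_of_nonneg_left (hL x y) (abs_nonneg c)

theorem lipConst_add_le (hf : IsLipA A f) (hg : IsLipA A g) :
    lipConst A (f + g) ≤ lipConst A f + lipConst A g := by
  refine lipConst_le (add_nonneg lipConst_nonneg lipConst_nonneg) fun k x y h => ?_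
  have h1 := abs_add_le (f x - f y) (g x - g y)
  have e : (f + g) x - (f + g) y = (f x - f y) + (g x - g y) := by
    simp only [Pi.add_apply]; ring
  rw [e, add_mul]
  linarith [hf.abs_sub_le h, hg.abs_sub_le h]

theorem supNorm_add_le (hf : IsLipA A f) (hg : IsLipA A g) :
    supNorm (f + g) ≤ supNorm f + supNorm g :=
  Real.iSup_le (fun x => (abs_add_le (f x) (g x)).trans
    (add_le_add (hf.abs_le_supNorm x) (hg.abs_le_supNorm x)))
    (add_nonneg supNorm_nonneg supNorm_nonneg)

theorem lipConst_smul_le (c : ℝ) (hf : IsLipA A f) :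
    lipConst A (c • f) ≤ |c| * lipConst A f := by
  refine lipConst_le (mul_nonneg (abs_nonneg c) lipConst_nonneg) fun k x y h => ?_
  have e : (c • f) x - (c • f) y = c * (f x - f y) := by
    simp only [Pi.smul_apply, smul_eq_mul]; ring
  rw [e, abs_mul, mul_assoc]
  exact mul_le_mul_of_nonneg_left (hf.abs_sub_le h) (abs_nonneg c)

theorem supNorm_smul_le (c : ℝ) (hf : IsLipA A f) :
    supNorm (c • f) ≤ |c| * supNorm f := by
  refine Real.iSup_le (fun x => ?_) (mul_nonneg (abs_nonneg c) supNorm_nonneg)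
  rw [Pi.smul_apply, smul_eq_mul, abs_mul]
  exact mul_le_mul_of_nonneg_left (hf.abs_le_supNorm x) (abs_nonneg c)

end Helpers

/-- The `d_A`-Lipschitz functions, as a linear subspace of all real functions. -/
def lipSubmodule (α : Type*) (A : ASequence) : Submodule ℝ ((ℕ → α) → ℝ) where
  carrier := {f | IsLipA A f}
  add_mem' hf hg := hf.add hg
  zero_mem' := ⟨0, fun x y => by simp⟩
  smul_mem' c _ hf := hf.smul c

/-- The space `C_A(Ω)`, `Ω = α^ℕ`. It is a type of its own, so that its topology is that of the
`A`-norm below and not the topology of pointwise convergence. -/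
def CA (α : Type*) (A : ASequence) : Type _ := lipSubmodule α A

namespace CA

variable {α : Type*} {A : ASequence}

noncomputable instance : AddCommGroup (CA α A) := inferInstanceAs (AddCommGroup (lipSubmodule α A))

noncomputable instance : Module ℝ (CA α A) := inferInstanceAs (Module ℝ (lipSubmodule α A))

/-- The function underlying an element of `C_A(Ω)`. -/
def toFun (f : CA α A) : (ℕ → α) → ℝ := f.1

theorem isLipA (f : CA α A) : IsLipA A f.toFun := f.2

/-- The `A`-norm `‖f‖_A = Lip_A(f) + ‖f‖_∞`. -/
noncomputable def aNorm (f : CA α A) : ℝ := lipConst A f.toFun + supNorm f.toFun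

theorem aNorm_smul_le (c : ℝ) (f : CA α A) : aNorm (c • f) ≤ |c| * aNorm f := by
  unfold aNorm
  rw [mul_add]
  exact add_le_add (lipConst_smul_le c f.isLipA) (supNorm_smul_le c f.isLipA)

noncomputable instance : NormedAddCommGroup (CA α A) :=
  AddGroupNorm.toNormedAddCommGroup
    { toFun := aNorm
      map_zero' := by
        have h := aNorm_smul_le (0 : ℝ) (0 : CA α A)
        rw [zero_smul, abs_zero, zero_mul] at h
        exact le_antisymm h (add_nonneg lipConst_nonneg supNorm_nonneg)
      add_le' := fun f g => by
        have h1 := lipConst_add_le f.isLipA g.isLipA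
        have h2 := supNorm_add_le f.isLipA g.isLipA
        have e : (f + g).toFun = f.toFun + g.toFun := rfl
        unfold aNorm
        rw [e]
        linarith
      neg' := fun f => by
        have h : ∀ g : CA α A, aNorm (-g) ≤ aNorm g := fun g => by
          have := aNorm_smul_le (-1 : ℝ) g
          rwa [neg_one_smul, abs_neg, abs_one, one_mul] at this
        refine le_antisymm (h f) ?_
        have := h (-f)
        rwa [neg_neg] at this
      eq_zero_of_map_eq_zero' := fun f hf => by
        have h1 : 0 ≤ lipConst A f.toFun := lipConst_nonneg
        have h2 : 0 ≤ supNorm f.toFun := supNorm_nonneg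
        have h3 : lipConst A f.toFun + supNorm f.toFun = 0 := hf
        refine Subtype.ext (funext fun x => ?_)
        have h4 := f.isLipA.abs_le_supNorm x
        exact abs_eq_zero.1 (le_antisymm (by linarith : |f.toFun x| ≤ 0) (abs_nonneg _)) }

noncomputable instance : NormedSpace ℝ (CA α A) where
  norm_smul_le c f := aNorm_smul_le c f

end CA

/-- `μ` is a shift-invariant (Borel) probability measure on `ℕ → α`. -/
def IsInvariantProb {α : Type*} [MeasurableSpace α] (μ : Measure (ℕ → α)) : Prop :=
  IsProbabilityMeasure μ ∧ MeasurePreserving shift μ μ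

/-- `μ` is a maximizing (optimizing) measure for `f`. -/
def IsMaximizing {α : Type*} [MeasurableSpace α] (f : (ℕ → α) → ℝ) (μ : Measure (ℕ → α)) : Prop :=
  IsInvariantProb μ ∧ ∀ ν : Measure (ℕ → α), IsInvariantProb ν → ∫ x, f x ∂ν ≤ ∫ x, f x ∂μ

/-- The periodic orbit measure `μ_y = (1/p) ∑_{i<p} δ_{Tⁱy}`, where `p` is the least period of the
periodic point `y`. -/
noncomputable def orbitMeasure {α : Type*} [MeasurableSpace α] (y : ℕ → α) : Measure (ℕ → α) :=
  (Function.minimalPeriod shift y : ENNReal)⁻¹ •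
    ∑ i ∈ Finset.range (Function.minimalPeriod shift y), Measure.dirac (shift^[i] y)

/-- `P_y`: the functions in `C_A(Ω)` whose unique maximizing measure is `μ_y`. -/
def P {α : Type*} [MeasurableSpace α] (A : ASequence) (y : ℕ → α) : Set (CA α A) :=
  {f | IsMaximizing f.toFun (orbitMeasure y) ∧
    ∀ ν : Measure (ℕ → α), IsMaximizing f.toFun ν → ν = orbitMeasure y}

end SuperCont

/-!
Write `T` for the shift and `S_n` for Birkhoff sums. Completeness is the usual argument with
pointwise limits. If the alphabet has two letters, the functions `shellDist A a S`, indexed by the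
sets `S` of natural numbers, form an uncountable `1`-separated family, so that the space is not
separable.

For the density, let `f` be Lipschitz and let `b` be the supremum of its averages over periodic
orbits. By Mañé's lemma (`exists_subaction`) there is a function `u` for which
`F = f - b + u - u ∘ T` is nonpositive; because `A_n` dominates its own tails, `F` has the same
regularity as `f`. For each `N`, the definition of `b` gives long orbit segments with `S_n F` close
to `0`, and a shortest return within such a segment to a word of length `N` closes up to a periodic
orbit `O` (`exists_periodic_orbit`). Words of length `N` are distinct along `O`, while the sum of
`F` over `O` is at least `-const * A_{N+1}`.

Now subtract `ε d_A(·, O)`. An orbit that leaves the `(N+1)`-cylinders around `O` pays at least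
`ε A_N`, whereas all that it can gain by shadowing a piece of `O` is of order `A_{N+1}`. Since
`A_{N+1} / A_N → 0`, the penalty wins for large `N`, also after any further perturbation that is
small in terms of `O`. This comparison is expressed by a transfer function
(`Separated.exists_cohomologous_le`): up to a bounded coboundary, the perturbed function is at most
its average over `O`, and smaller by a definite amount off the cylinders. Integration shows that a
maximizing measure is carried by the cylinders, hence by `O` (`Separated.eq_orbitMeasure`). No
compactness of the space of invariant measures is used.
-/

namespace SuperCont

variable {α : Type*} {A : ASequence}

/-! ### Agreement of initial words, and functions with prescribed variation -/

/-- `x` and `y` have the same first `k` symbols. -/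
abbrev Agree (k : ℕ) (x y : ℕ → α) : Prop := ∀ i < k, x i = y i

theorem Agree.symm {k : ℕ} {x y : ℕ → α} (h : Agree k x y) : Agree k y x :=
  fun i hi => (h i hi).symm

theorem Agree.trans {k : ℕ} {x y z : ℕ → α} (h : Agree k x y) (h' : Agree k y z) : Agree k x z :=
  fun i hi => (h i hi).trans (h' i hi)

theorem Agree.mono {k l : ℕ} {x y : ℕ → α} (h : Agree k x y) (hl : l ≤ k) : Agree l x y :=
  fun i hi => h i (hi.trans_le hl)

theorem iterate_shift_apply (n : ℕ) (x : ℕ → α) (i : ℕ) : shift^[n] x i = x (n + i) := by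
  induction n generalizing x with
  | zero => simp
  | succ n ih =>
    rw [Function.iterate_succ_apply, ih]
    exact congrArg x (by ring)

theorem Agree.iterate_shift {n k : ℕ} {x y : ℕ → α} (h : Agree (n + k) x y) :
    Agree k (shift^[n] x) (shift^[n] y) := by
  intro i hi
  rw [iterate_shift_apply, iterate_shift_apply]
  exact h _ (by omega)

theorem Agree.shift {k : ℕ} {x y : ℕ → α} (h : Agree (k + 1) x y) :
    Agree k (shift x) (shift y) := fun i hi => h _ (by omega)

/-- The variations of `g` satisfy `var_k g ≤ c A_k` for every `k`. -/
def VarLE (A : ASequence) (c : ℝ) (g : (ℕ → α) → ℝ) : Prop :=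
  ∀ (k : ℕ) (x y : ℕ → α), Agree k x y → |g x - g y| ≤ c * A.val k

theorem IsLipA.varLE {f : (ℕ → α) → ℝ} (hf : IsLipA A f) : VarLE A (lipConst A f) f :=
  fun _ _ _ h => hf.abs_sub_le h

theorem VarLE.mono {c c' : ℝ} {g : (ℕ → α) → ℝ} (h : VarLE A c g) (hc : c ≤ c') : VarLE A c' g :=
  fun k x y hxy => (h k x y hxy).trans (mul_le_mul_of_nonneg_right hc (A.pos k).le)

theorem VarLE.isLipA {c : ℝ} {g : (ℕ → α) → ℝ} (h : VarLE A c g) : IsLipA A g := by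
  refine ⟨c, fun x y => ?_⟩
  unfold dA
  split_ifs with hxy
  · simp [hxy]
  · exact h _ x y fun i hi => PiNat.apply_eq_of_lt_firstDiff hi

theorem VarLE.bounded {c : ℝ} {g : (ℕ → α) → ℝ} (h : VarLE A c g) : ∃ B : ℝ, ∀ x, |g x| ≤ B :=
  ⟨supNorm g, h.isLipA.abs_le_supNorm⟩

theorem VarLE.continuous [TopologicalSpace α] [DiscreteTopology α] {c : ℝ} {g : (ℕ → α) → ℝ}
    (h : VarLE A c g) : Continuous g := by
  rw [continuous_iff_continuousAt]
  intro x
  rw [Metric.continuousAt_iff']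
  intro ε hε
  have ht : Tendsto (fun k => c * A.val k) atTop (𝓝 0) := by
    simpa using A.tendsto_zero.const_mul c
  obtain ⟨k, hk⟩ := (ht.eventually_lt_const hε).exists
  have hmem := (PiNat.isOpen_cylinder (fun _ => α) x k).mem_nhds (PiNat.self_mem_cylinder x k)
  filter_upwards [hmem] with y hy
  exact (h k y x (PiNat.mem_cylinder_iff.1 hy)).trans_lt hk

/-! ### Summability of the sequence and shadowing -/

/-- A superexponentially decaying sequence dominates its own tails, uniformly. -/
theorem exists_sum_le (hA : Tendsto (fun n => A.val (n + 1) / A.val n) atTop (𝓝 0)) :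
    ∃ C : ℝ, 0 ≤ C ∧ ∀ k n : ℕ, ∑ j ∈ Finset.range n, A.val (k + j) ≤ C * A.val k := by
  obtain ⟨m, hm⟩ := eventually_atTop.1 (hA.eventually_lt_const (show (0 : ℝ) < 1 / 2 by norm_num))
  have half : ∀ k, m ≤ k → A.val (k + 1) ≤ A.val k / 2 := fun k hk => by
    have := (div_lt_iff₀ (A.pos k)).1 (hm k hk)
    linarith
  have tail : ∀ k, m ≤ k → ∀ n, ∑ j ∈ Finset.range n, A.val (k + j) + 2 * A.val (k + n) ≤
      2 * A.val k := by
    intro k hk n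
    induction n with
    | zero => simp
    | succ n ih =>
      rw [Finset.sum_range_succ]
      have := half (k + n) (by omega)
      have e : k + (n + 1) = k + n + 1 := by ring
      rw [e]
      linarith
  refine ⟨m + 2, by positivity, fun k n => ?_⟩
  have h1 : ∑ j ∈ Finset.range n, A.val (k + j) ≤ ∑ j ∈ Finset.range (m + n), A.val (k + j) :=
    Finset.sum_le_sum_of_subset_of_nonneg (Finset.range_mono (by omega))
      fun j _ _ => (A.pos _).le
  rw [Finset.sum_range_add] at h1
  have h2 : ∑ j ∈ Finset.range m, A.val (k + j) ≤ m * A.val k := by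
    have := Finset.sum_le_card_nsmul (Finset.range m) (fun j => A.val (k + j)) (A.val k)
      fun j _ => A.anti (by omega)
    simpa using this
  have h3 := tail (k + m) (by omega) n
  have h4 := A.pos (k + m + n)
  have h5 : A.val (k + m) ≤ A.val k := A.anti (by omega)
  simp only [← add_assoc] at h1
  nlinarith

/-- Birkhoff sums along two orbits that agree for `n` steps and for `k` symbols afterwards: the
discrepancies `A_{n+k}, …, A_{k+1}` sum up to a multiple of the last of them. -/
theorem abs_birkhoffSum_sub_le {f : (ℕ → α) → ℝ} {c C : ℝ} (hc : 0 ≤ c)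
    (hC : ∀ k n : ℕ, ∑ j ∈ Finset.range n, A.val (k + j) ≤ C * A.val k) {n k : ℕ} {x y : ℕ → α}
    (hf : ∀ l, k + 1 ≤ l → ∀ z w : ℕ → α, Agree l z w → |f z - f w| ≤ c * A.val l)
    (h : Agree (n + k) x y) :
    |birkhoffSum shift f n x - birkhoffSum shift f n y| ≤ c * C * A.val (k + 1) := by
  unfold birkhoffSum
  rw [← Finset.sum_sub_distrib]
  refine (Finset.abs_sum_le_sum_abs _ _).trans ?_
  have h1 : ∑ i ∈ Finset.range n, |f (shift^[i] x) - f (shift^[i] y)| ≤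
      ∑ i ∈ Finset.range n, c * A.val (k + 1 + (n - 1 - i)) := by
    refine Finset.sum_le_sum fun i hi => ?_
    rw [Finset.mem_range] at hi
    refine hf _ (by omega) _ _ (Agree.iterate_shift (h.mono ?_))
    omega
  refine h1.trans ?_
  rw [Finset.sum_range_reflect (fun j => c * A.val (k + 1 + j)) n, ← Finset.mul_sum, mul_assoc]
  exact mul_le_mul_of_nonneg_left (hC _ _) hc

/-! ### Periodic points and gluing -/

/-- The first `n` symbols of `z`, followed by `x`. -/
def glue (n : ℕ) (z x : ℕ → α) : ℕ → α := fun i => if i < n then z i else x (i - n)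

theorem iterate_shift_glue (n : ℕ) (z x : ℕ → α) : shift^[n] (glue n z x) = x := by
  funext i
  rw [iterate_shift_apply]
  simp [glue]

theorem agree_glue {n k : ℕ} {z x : ℕ → α} (h : Agree k (shift^[n] z) x) :
    Agree (n + k) z (glue n z x) := by
  intro i hi
  unfold glue
  split_ifs with hin
  · rfl
  · rw [← h (i - n) (by omega), iterate_shift_apply]
    congr 1
    omega

/-- The periodic sequence that repeats the first `n` symbols of `z`. -/
def periodize (n : ℕ) (z : ℕ → α) : ℕ → α := fun i => z (i % n)

theorem iterate_shift_periodize (n : ℕ) (z : ℕ → α) :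
    shift^[n] (periodize n z) = periodize n z := by
  funext i
  rw [iterate_shift_apply]
  simp [periodize]

/-- If `z` returns at time `n` to its initial word of length `k`, then the periodic sequence that
repeats the first `n` symbols of `z` shadows `z` for `n + k` symbols. -/
theorem agree_periodize {n k : ℕ} (hn : 0 < n) {z : ℕ → α} (h : Agree k z (shift^[n] z)) :
    Agree (n + k) (periodize n z) z := by
  intro i
  induction i using Nat.strong_induction_on with
  | _ i ih =>
    intro hi
    by_cases hin : i < n
    · simp [periodize, Nat.mod_eq_of_lt hin]
    · have h1 := ih (i - n) (by omega) (by omega)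
      have h2 := h (i - n) (by omega)
      rw [iterate_shift_apply, show n + (i - n) = i by omega] at h2
      rw [← h2, ← h1]
      unfold periodize
      rw [Nat.mod_eq_sub_mod (by omega : i ≥ n)]

theorem birkhoffSum_mul_of_iterate_eq {f : (ℕ → α) → ℝ} {n : ℕ} {z : ℕ → α}
    (hz : shift^[n] z = z) (m : ℕ) :
    birkhoffSum shift f (n * m) z = m * birkhoffSum shift f n z := by
  induction m with
  | zero => simp
  | succ m ih =>
    have hm : shift^[n * m] z = z := by
      rw [Function.iterate_mul]
      exact Function.iterate_fixed hz m
    rw [Nat.mul_succ, birkhoffSum_add, ih, hm]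
    push_cast
    ring

theorem birkhoffSum_coboundary (u : (ℕ → α) → ℝ) (n : ℕ) (x : ℕ → α) :
    birkhoffSum shift (fun z => u z - u (shift z)) n x = u x - u (shift^[n] x) := by
  induction n with
  | zero => simp
  | succ n ih =>
    rw [birkhoffSum_succ, ih, Function.iterate_succ_apply']
    ring

theorem birkhoffSum_sub_const (f : (ℕ → α) → ℝ) (b : ℝ) (n : ℕ) (x : ℕ → α) :
    birkhoffSum shift (fun z => f z - b) n x = birkhoffSum shift f n x - n * b := by
  simp [birkhoffSum]

/-! ### A sub-action -/

/-- The values of the averages of `f` over periodic orbits. -/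
def periodicMeans (f : (ℕ → α) → ℝ) : Set ℝ :=
  {r | ∃ (z : ℕ → α) (n : ℕ), 0 < n ∧ shift^[n] z = z ∧ r = birkhoffSum shift f n z / n}

theorem bddAbove_periodicMeans {f : (ℕ → α) → ℝ} {B : ℝ} (hB : ∀ x, |f x| ≤ B) :
    BddAbove (periodicMeans f) := by
  refine ⟨B, ?_⟩
  rintro _ ⟨z, n, hn, -, rfl⟩
  rw [div_le_iff₀ (by exact_mod_cast hn)]
  have := Finset.sum_le_card_nsmul (Finset.range n) (fun i => f (shift^[i] z)) B
    fun i _ => (le_abs_self _).trans (hB _)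
  simpa [birkhoffSum, mul_comm] using this

theorem periodicMeans_nonempty [Nonempty α] (f : (ℕ → α) → ℝ) : (periodicMeans f).Nonempty := by
  obtain ⟨a⟩ := ‹Nonempty α›
  exact ⟨_, fun _ => a, 1, one_pos, rfl, rfl⟩

/-- **Mañé's lemma.** There are a constant `b` and a sub-action `u` such that `f - b` is bounded
above by the coboundary `u ∘ T - u`, and `b` is the supremum of the averages of `f` over periodic
orbits. The function `u x` is the supremum of the Birkhoff sums of `f - b` over the finite orbit
segments that end in `x`; since the preimage branches contract `d_A`, it inherits the regularity
of `f`. -/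
theorem exists_subaction {f : (ℕ → α) → ℝ} {L C : ℝ} (hL : 0 ≤ L) (hf : VarLE A L f)
    (hC : ∀ k n : ℕ, ∑ j ∈ Finset.range n, A.val (k + j) ≤ C * A.val k) :
    ∃ u : (ℕ → α) → ℝ,
      (∀ x, f x - sSup (periodicMeans f) + u x - u (shift x) ≤ 0) ∧
      ∀ (k : ℕ) (x y : ℕ → α), Agree k x y → |u x - u y| ≤ L * C * A.val (k + 1) := by
  set b := sSup (periodicMeans f) with hb
  obtain ⟨B, hB⟩ := hf.bounded
  let S : (ℕ → α) → Set ℝ := fun x =>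
    {r | ∃ (n : ℕ) (z : ℕ → α), shift^[n] z = x ∧ r = birkhoffSum shift (fun z => f z - b) n z}
  have hbdd : ∀ x, ∀ r ∈ S x, r ≤ L * C * A.val 1 := by
    rintro x _ ⟨n, z, -, rfl⟩
    rw [birkhoffSum_sub_const]
    rcases Nat.eq_zero_or_pos n with rfl | hn
    · have h := hC 1 0
      have : 0 ≤ L * (C * A.val 1) := mul_nonneg hL (by simpa using h)
      simpa [mul_assoc] using this
    have h1 : birkhoffSum shift f n (periodize n z) / n ≤ b :=
      le_csSup (bddAbove_periodicMeans hB) ⟨_, n, hn, iterate_shift_periodize n z, rfl⟩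
    rw [div_le_iff₀ (by exact_mod_cast hn)] at h1
    have h2 := abs_birkhoffSum_sub_le hL hC (n := n) (k := 0) (f := f) (x := periodize n z)
      (y := z) (fun l _ => hf l) (agree_periodize hn fun i hi => absurd hi (Nat.not_lt_zero i))
    rw [zero_add] at h2
    have := (abs_le.1 h2).1
    linarith [mul_comm b (n : ℝ)]
  have hne : ∀ x, (S x).Nonempty := fun x => ⟨_, 0, x, rfl, rfl⟩
  have hle : ∀ x, ∀ r ∈ S x, r ≤ sSup (S x) := fun x r hr => le_csSup ⟨_, hbdd x⟩ hr
  refine ⟨fun x => sSup (S x), fun x => ?_, fun k x y hxy => ?_⟩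
  · have : sSup (S x) ≤ sSup (S (shift x)) - (f x - b) := by
      refine csSup_le (hne x) ?_
      rintro _ ⟨n, z, hz, rfl⟩
      have := hle (shift x) _ ⟨n + 1, z, by rw [Function.iterate_succ_apply', hz], rfl⟩
      rw [birkhoffSum_succ, hz] at this
      linarith
    simp only
    linarith
  · have key : ∀ x y : ℕ → α, Agree k x y → sSup (S x) ≤ sSup (S y) + L * C * A.val (k + 1) := by
      intro x y hxy
      refine csSup_le (hne x) ?_
      rintro _ ⟨n, z, hz, rfl⟩
      have h1 := hle y _ ⟨n, glue n z y, iterate_shift_glue n z y, rfl⟩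
      have h2 := abs_birkhoffSum_sub_le hL hC (n := n) (k := k) (f := fun z => f z - b) (x := z)
        (y := glue n z y) (fun l _ z w hzw => by simpa using hf l z w hzw)
        (agree_glue (by rw [hz]; exact hxy))
      have := (abs_le.1 h2).2
      linarith
    rw [abs_le]
    constructor <;> linarith [key x y hxy, key y x hxy.symm]

/-! ### Periodic orbits of almost maximal average -/

/-- If `b` is the supremum of the averages of `f` over periodic orbits, then the Birkhoff sums of
length `M` of the normalized function `f - b + u - u ∘ T` come arbitrarily close to `0`. -/
theorem exists_birkhoffSum_gt [Nonempty α] {f u : (ℕ → α) → ℝ} {M : ℕ} (hM : 0 < M) {δ : ℝ}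
    (hδ : 0 < δ) :
    ∃ w, -δ < birkhoffSum shift
      (fun x => f x - sSup (periodicMeans f) + u x - u (shift x)) M w := by
  set b := sSup (periodicMeans f) with hb
  set F := fun x => f x - b + u x - u (shift x) with hF
  by_contra! hcon
  have hM' : (0 : ℝ) < M := by exact_mod_cast hM
  have h1 : ∀ (n : ℕ) (x : ℕ → α), birkhoffSum shift F (M * n) x ≤ n * -δ := by
    intro n
    induction n with
    | zero => simp
    | succ n ih =>
      intro x
      rw [Nat.mul_succ, birkhoffSum_add]
      push_cast
      linarith [ih x, hcon (shift^[M * n] x)]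
  have h2 : b ≤ b - δ / M := by
    refine csSup_le (periodicMeans_nonempty f) ?_
    rintro _ ⟨z, n, hn, hz, rfl⟩
    have hn' : (0 : ℝ) < n := by exact_mod_cast hn
    have h3 : birkhoffSum shift F n z = birkhoffSum shift f n z - n * b := by
      have e : F = (fun x => f x - b) + fun x => u x - u (shift x) := by
        funext x
        simp only [hF, Pi.add_apply]
        ring
      rw [e, birkhoffSum_add', birkhoffSum_sub_const, birkhoffSum_coboundary, hz, sub_self,
        add_zero]
    have h4 := h1 n z
    rw [mul_comm M n, birkhoffSum_mul_of_iterate_eq hz, h3] at h4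
    rw [div_le_iff₀ hn']
    have h5 : birkhoffSum shift f n z - n * b ≤ n * -δ / M := by
      rw [le_div_iff₀ hM']
      linarith
    have h6 : (b - δ / M) * n = n * b + n * -δ / M := by ring
    linarith
  have := div_pos hδ hM'
  linarith

/-- A window of length `|α|^N` contains a return to some word of length `N`; periodizing a shortest
return gives a periodic orbit whose words of length `N` are pairwise distinct, and whose Birkhoff
sum is that of the window up to a multiple of `A_{N+1}`. -/
theorem exists_periodic_orbit [Finite α] [Nonempty α] {f u : (ℕ → α) → ℝ} {c C : ℝ} (hc : 0 ≤ c)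
    (hC : ∀ k n : ℕ, ∑ j ∈ Finset.range n, A.val (k + j) ≤ C * A.val k)
    (hneg : ∀ x, f x - sSup (periodicMeans f) + u x - u (shift x) ≤ 0)
    (hF : ∀ k, 1 ≤ k → ∀ x y : ℕ → α, Agree k x y →
      |(f x - sSup (periodicMeans f) + u x - u (shift x)) -
        (f y - sSup (periodicMeans f) + u y - u (shift y))| ≤ c * A.val k) (N : ℕ) :
    ∃ y ∈ Function.periodicPts (shift (α := α)),
      (∀ i j, Agree N (shift^[i] y) (shift^[j] y) → shift^[i] y = shift^[j] y) ∧
      -((c * C + 1) * A.val (N + 1)) ≤ birkhoffSum shift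
        (fun x => f x - sSup (periodicMeans f) + u x - u (shift x))
        (Function.minimalPeriod shift y) y := by
  classical
  obtain ⟨w, hw⟩ := exists_birkhoffSum_gt (f := f) (u := u)
    (Nat.card_pos : 0 < Nat.card (Fin N → α)) (A.pos (N + 1))
  set F := fun x => f x - sSup (periodicMeans f) + u x - u (shift x) with hFdef
  set M := Nat.card (Fin N → α) with hM
  have := Fintype.ofFinite α
  -- the shortest return within the window
  have hex : ∃ d, 0 < d ∧ ∃ i, i + d ≤ M ∧ Agree N (shift^[i] w) (shift^[i + d] w) := by
    obtain ⟨i, j, hij, he⟩ := Fintype.exists_ne_map_eq_of_card_lt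
      (fun (i : Fin (M + 1)) (l : Fin N) => shift^[(i : ℕ)] w l)
      (by rw [Fintype.card_fin, hM, Nat.card_eq_fintype_card]; omega)
    have key : ∀ i j : Fin (M + 1), i < j →
        (fun l : Fin N => shift^[(i : ℕ)] w l) = (fun l : Fin N => shift^[(j : ℕ)] w l) →
        ∃ d, 0 < d ∧ ∃ i, i + d ≤ M ∧ Agree N (shift^[i] w) (shift^[i + d] w) := by
      intro i j hlt he
      have hlt' : (i : ℕ) < j := hlt
      refine ⟨j - i, by omega, i, by omega, fun l hl => ?_⟩
      rw [show (i : ℕ) + (j - i) = j by omega]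
      exact congrFun he ⟨l, hl⟩
    rcases lt_or_gt_of_ne hij with h | h
    · exact key i j h he
    · exact key j i h he.symm
  obtain ⟨hp, i, hiM, hret⟩ := Nat.find_spec hex
  have hmin := fun {d : ℕ} (hd : d < Nat.find hex) => Nat.find_min hex hd
  set p := Nat.find hex with hpdef
  set z := shift^[i] w with hz
  set y := periodize p z with hy
  have hyz : Agree (p + N) y z := by
    refine agree_periodize hp ?_
    rwa [hz, ← Function.iterate_add_apply, add_comm p i]
  have hyp : shift^[p] y = y := iterate_shift_periodize p z
  have hdist : ∀ a b, a < b → b < p → ¬ Agree N (shift^[a] y) (shift^[b] y) := by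
    intro a b hab hbp hag
    refine hmin (d := b - a) (by omega) ⟨by omega, i + a, by omega, ?_⟩
    have h1 : Agree N (shift^[a] y) (shift^[a] z) := Agree.iterate_shift (hyz.mono (by omega))
    have h2 : Agree N (shift^[b] y) (shift^[b] z) := Agree.iterate_shift (hyz.mono (by omega))
    have h3 := (h1.symm.trans hag).trans h2
    rw [hz, ← Function.iterate_add_apply, ← Function.iterate_add_apply] at h3
    rwa [show i + a + (b - a) = b + i by omega, add_comm i a]
  have hper : Function.minimalPeriod shift y = p := by
    have hle : Function.minimalPeriod shift y ≤ p :=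
      Function.IsPeriodicPt.minimalPeriod_le hp hyp
    have hpos : 0 < Function.minimalPeriod shift y :=
      Function.minimalPeriod_pos_of_mem_periodicPts ⟨p, hp, hyp⟩
    refine hle.antisymm (not_lt.1 fun hlt => hdist 0 _ hpos hlt ?_)
    rw [Function.iterate_minimalPeriod]
    exact fun _ _ => rfl
  refine ⟨y, ⟨p, hp, hyp⟩, fun a b hab => ?_, ?_⟩
  · rw [← Function.iterate_mod_minimalPeriod_eq (n := a),
      ← Function.iterate_mod_minimalPeriod_eq (n := b), hper] at hab ⊢
    have ha := Nat.mod_lt a hp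
    have hb := Nat.mod_lt b hp
    rcases lt_trichotomy (a % p) (b % p) with h | h | h
    · exact absurd hab (hdist _ _ h hb)
    · rw [h]
    · exact absurd hab.symm (hdist _ _ h ha)
  · rw [hper]
    have h1 := (abs_le.1 (abs_birkhoffSum_sub_le (f := F) hc hC
      (fun l hl => hF l (by omega)) hyz)).1
    have hnp : ∀ n x, birkhoffSum shift F n x ≤ 0 := fun n x =>
      Finset.sum_nonpos fun j _ => hneg _
    have h2 : birkhoffSum shift F M w ≤ birkhoffSum shift F p z := by
      rw [show M = i + (p + (M - i - p)) by omega, birkhoffSum_add, birkhoffSum_add]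
      linarith [hnp i w, hnp (M - i - p) (shift^[p] (shift^[i] w))]
    linarith

/-! ### The distance to a periodic orbit -/

theorem le_dA_of_not_agree {k : ℕ} {x z : ℕ → α} (h : ¬ Agree (k + 1) x z) :
    A.val k ≤ dA A x z := by
  unfold dA
  split_ifs with hxz
  · exact absurd (fun i _ => congrFun hxz i) h
  · refine A.anti (not_lt.1 fun hlt => h fun i hi => ?_)
    exact PiNat.apply_eq_of_lt_firstDiff (E := fun _ => α) (by omega)

theorem dA_le_add {k : ℕ} {x x' : ℕ → α} (h : Agree k x x') (z : ℕ → α) :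
    dA A x z ≤ dA A x' z + A.val k := by
  by_cases hz : x' = z
  · subst hz
    linarith [dA_le (A := A) h, dA_nonneg (A := A) x' x']
  · have e : dA A x' z = A.val (PiNat.firstDiff x' z) := if_neg hz
    rw [e]
    rcases le_total k (PiNat.firstDiff x' z) with hk | hk
    · have h1 : Agree k x z := h.trans fun i hi =>
        PiNat.apply_eq_of_lt_firstDiff (E := fun _ => α) (by omega)
      linarith [dA_le (A := A) h1, A.pos (PiNat.firstDiff x' z)]
    · have h1 : Agree (PiNat.firstDiff x' z) x z := (h.mono hk).trans fun i hi =>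
        PiNat.apply_eq_of_lt_firstDiff (E := fun _ => α) hi
      linarith [dA_le (A := A) h1, A.pos k]

theorem dA_self (x : ℕ → α) : dA A x x = 0 := if_pos rfl

/-- The `d_A`-distance of `x` from the forward orbit of `y`. -/
noncomputable def orbitDist (A : ASequence) (y x : ℕ → α) : ℝ := ⨅ i : ℕ, dA A x (shift^[i] y)

theorem orbitDist_le (y x : ℕ → α) (i : ℕ) : orbitDist A y x ≤ dA A x (shift^[i] y) :=
  ciInf_le ⟨0, by rintro _ ⟨j, rfl⟩; exact dA_nonneg _ _⟩ i

theorem orbitDist_nonneg (y x : ℕ → α) : 0 ≤ orbitDist A y x :=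
  le_ciInf fun _ => dA_nonneg _ _

theorem orbitDist_iterate (y : ℕ → α) (i : ℕ) : orbitDist A y (shift^[i] y) = 0 :=
  le_antisymm ((orbitDist_le y _ i).trans_eq (dA_self _)) (orbitDist_nonneg _ _)

theorem orbitDist_le_val_zero (y x : ℕ → α) : orbitDist A y x ≤ A.val 0 :=
  (orbitDist_le y x 0).trans (dA_le fun i hi => absurd hi (Nat.not_lt_zero i))

theorem varLE_orbitDist (y : ℕ → α) : VarLE A 1 (orbitDist A y) := by
  have key : ∀ (k : ℕ) (x x' : ℕ → α), Agree k x x' →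
      orbitDist A y x ≤ orbitDist A y x' + A.val k := by
    intro k x x' h
    rw [← sub_le_iff_le_add]
    refine le_ciInf fun i => ?_
    linarith [orbitDist_le (A := A) y x i, dA_le_add (A := A) h (shift^[i] y)]
  intro k x x' h
  rw [one_mul, abs_le]
  constructor <;> linarith [key k x x' h, key k x' x h.symm]

/-- Distinct points of the orbit of `y` have distinct initial words of length `N`. -/
def Separated (N : ℕ) (y : ℕ → α) : Prop :=
  ∀ i j, Agree N (shift^[i] y) (shift^[j] y) → shift^[i] y = shift^[j] y

/-- The points that agree with some point of the orbit of `y` for `k` symbols. -/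
def orbitNhd (k : ℕ) (y : ℕ → α) : Set (ℕ → α) := {x | ∃ i, Agree k x (shift^[i] y)}

theorem isOpen_orbitNhd [TopologicalSpace α] [DiscreteTopology α] (k : ℕ) (y : ℕ → α) :
    IsOpen (orbitNhd k y) := by
  have : orbitNhd k y = ⋃ i, PiNat.cylinder (E := fun _ => α) (shift^[i] y) k := by
    ext x
    simp only [orbitNhd, Set.mem_ofPred_eq, Set.mem_iUnion, PiNat.mem_cylinder_iff]
  rw [this]
  exact isOpen_iUnion fun i => PiNat.isOpen_cylinder _ _ _

theorem le_orbitDist_of_notMem {k : ℕ} {y x : ℕ → α} (h : x ∉ orbitNhd (k + 1) y) :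
    A.val k ≤ orbitDist A y x :=
  le_ciInf fun i => le_dA_of_not_agree fun hi => h ⟨i, hi⟩

/-- Close to a separated orbit, the nearest point of the orbit is the one that agrees with `x`. -/
theorem Separated.orbitDist_eq {N i : ℕ} {y x : ℕ → α} (hs : Separated N y)
    (h : Agree (N + 1) x (shift^[i] y)) : orbitDist A y x = dA A x (shift^[i] y) := by
  refine (orbitDist_le y x i).antisymm (le_ciInf fun j => ?_)
  by_cases hj : Agree (N + 1) x (shift^[j] y)
  · rw [hs i j ((h.symm.trans hj).mono (by omega))]
  · exact ((dA_le h).trans (A.anti (by omega))).trans (le_dA_of_not_agree hj)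

/-- The shift at least doubles the distance from the orbit, as long as the latter is small. -/
theorem Separated.two_mul_orbitDist_le {N : ℕ} {y x : ℕ → α} (hs : Separated N y)
    (hA : ∀ k, N ≤ k → 2 * A.val (k + 1) ≤ A.val k) (h : x ∈ orbitNhd (N + 1) y) :
    2 * orbitDist A y x ≤ min (orbitDist A y (shift x)) (2 * A.val (N + 1)) := by
  obtain ⟨i, hi⟩ := h
  have hD : orbitDist A y x ≤ A.val (N + 1) := (orbitDist_le y x i).trans (dA_le hi)
  refine le_min (le_ciInf fun j => ?_) (by linarith)
  by_cases hj : Agree N (shift x) (shift^[j] y)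
  · have h1 : Agree N (shift x) (shift (shift^[i] y)) := hi.shift
    rw [← Function.iterate_succ_apply' shift] at h1
    rw [← hs (i + 1) j (h1.symm.trans hj), Function.iterate_succ_apply', hs.orbitDist_eq hi]
    set z := shift^[i] y
    by_cases hxz : x = z
    · rw [hxz, dA_self, dA_self, mul_zero]
    · have e : dA A x z = A.val (PiNat.firstDiff x z) := if_neg hxz
      have hne := PiNat.apply_firstDiff_ne hxz
      have hN : N + 1 ≤ PiNat.firstDiff x z := not_lt.1 fun hlt => hne (hi _ hlt)
      obtain ⟨n, hn⟩ := Nat.exists_eq_add_of_lt (show N < PiNat.firstDiff x z by omega)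
      rw [e, hn]
      refine (hA (N + n) (by omega)).trans (le_dA_of_not_agree fun hag => hne ?_)
      rw [hn]
      exact hag (N + n) (by omega)
  · have h2 := le_dA_of_not_agree (A := A) fun hag => hj (Agree.mono hag (Nat.le_succ N))
    linarith [hA N le_rfl]

/-! ### A periodic orbit that locks the maximizing measure -/

/-- A function on a periodic orbit with vanishing sum is a coboundary, with a transfer function
that is given by the partial sums; it extends to a function of the first `N` symbols. -/
theorem Separated.exists_transfer [Finite α] [MeasurableSpace α] [MeasurableSingletonClass α]
    {N : ℕ} {y : ℕ → α} (hs : Separated N y)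
    (hy : y ∈ Function.periodicPts (shift (α := α))) {q : (ℕ → α) → ℝ} {K : ℝ}
    (hq : birkhoffSum shift q (Function.minimalPeriod shift y) y = 0)
    (hK : ∑ i ∈ Finset.range (Function.minimalPeriod shift y), |q (shift^[i] y)| ≤ K) :
    ∃ V : (ℕ → α) → ℝ, Measurable V ∧ (∀ x, |V x| ≤ K) ∧
      ∀ x i, Agree N x (shift^[i] y) → V x = birkhoffSum shift q i y := by
  classical
  have hp := Function.minimalPeriod_pos_of_mem_periodicPts hy
  set p := Function.minimalPeriod shift y with hpdef
  have hmod : ∀ i, birkhoffSum shift q i y = birkhoffSum shift q (i % p) y := by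
    intro i
    have h1 : shift^[p] y = y := Function.iterate_minimalPeriod
    have h2 : shift^[p * (i / p)] y = y := by
      rw [Function.iterate_mul]
      exact Function.iterate_fixed h1 _
    conv_lhs => rw [← Nat.div_add_mod i p, birkhoffSum_add, birkhoffSum_mul_of_iterate_eq h1, hq,
      mul_zero, zero_add, h2]
  have heq : ∀ i j, shift^[i] y = shift^[j] y →
      birkhoffSum shift q i y = birkhoffSum shift q j y := by
    intro i j hij
    rw [← Function.iterate_mod_minimalPeriod_eq (n := i),
      ← Function.iterate_mod_minimalPeriod_eq (n := j)] at hij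
    rw [hmod i, hmod j, Function.iterate_injOn_Iio_minimalPeriod (Nat.mod_lt i hp)
      (Nat.mod_lt j hp) hij]
  have hbd : ∀ i, |birkhoffSum shift q i y| ≤ K := by
    intro i
    rw [hmod]
    refine ((Finset.abs_sum_le_sum_abs _ _).trans ?_).trans hK
    exact Finset.sum_le_sum_of_subset_of_nonneg (Finset.range_mono (Nat.mod_lt i hp).le)
      fun _ _ _ => abs_nonneg _
  let φ : (Fin N → α) → ℝ := fun w =>
    if h : ∃ i, ∀ l : Fin N, w l = shift^[i] y l then birkhoffSum shift q h.choose y else 0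
  refine ⟨fun x => φ fun l => x l, ?_, fun x => ?_, fun x i hi => ?_⟩
  · exact (Measurable.of_discrete (f := φ)).comp
      (measurable_pi_lambda _ fun l => measurable_pi_apply (l : ℕ))
  · simp only [φ]
    split_ifs
    · exact hbd _
    · simpa using (abs_nonneg _).trans (hbd 0)
  · have h : ∃ i, ∀ l : Fin N, x l = shift^[i] y l := ⟨i, fun l => hi l l.2⟩
    simp only [φ]
    rw [dif_pos h]
    refine heq _ _ (hs _ _ fun l hl => ?_)
    rw [← h.choose_spec ⟨l, hl⟩]
    exact hi l hl

/-- The penalized function `Q - ε d_A(·, O)` is cohomologous to one that is at most the average of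
`Q` over the orbit `O`, and smaller by a definite amount outside the `(N+1)`-cylinders around `O`.
The transfer function is a sum of two: one makes `Q` constant on `O`, the other,
a truncated multiple of the distance to `O`, absorbs the variation of `Q` along orbit segments
that shadow `O`. -/
theorem Separated.exists_cohomologous_le [Finite α] [TopologicalSpace α] [DiscreteTopology α]
    [MeasurableSpace α] [BorelSpace α] {N : ℕ} {y : ℕ → α} (hs : Separated N y)
    (hy : y ∈ Function.periodicPts (shift (α := α)))
    (hA : ∀ k, N ≤ k → 2 * A.val (k + 1) ≤ A.val k) {Q : (ℕ → α) → ℝ} {C ε : ℝ} (hC : 0 ≤ C)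
    (hε : 0 ≤ ε) (hQ : ∀ x, Q x ≤ A.val (N + 1))
    (hvar : ∀ k, N + 1 ≤ k → ∀ x z : ℕ → α, Agree k x z → |Q x - Q z| ≤ C * A.val k)
    (hsum : ∑ i ∈ Finset.range (Function.minimalPeriod shift y), |Q (shift^[i] y)| ≤
      C * A.val (N + 1))
    (hgap : (1 + 7 * C) * A.val (N + 1) < ε * A.val N) :
    ∃ (v : (ℕ → α) → ℝ) (c : ℝ), Measurable v ∧ (∃ B, ∀ x, |v x| ≤ B) ∧ 0 < c ∧
      (∀ x, Q x - ε * orbitDist A y x + v x - v (shift x) ≤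
        birkhoffSum shift Q (Function.minimalPeriod shift y) y / Function.minimalPeriod shift y -
          c * (orbitNhd (N + 1) y)ᶜ.indicator (fun _ => 1) x) := by
  have hp := Function.minimalPeriod_pos_of_mem_periodicPts hy
  set p := Function.minimalPeriod shift y with hpdef
  have hp' : (1 : ℝ) ≤ p := by exact_mod_cast hp
  have hp0 : (p : ℝ) ≠ 0 := by positivity
  set m := birkhoffSum shift Q p y / p with hm
  have hpm : p * |m| ≤ C * A.val (N + 1) := by
    rw [hm, abs_div, Nat.abs_cast, mul_div_cancel₀ _ hp0]
    exact (Finset.abs_sum_le_sum_abs _ _).trans hsum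
  have hm' : |m| ≤ C * A.val (N + 1) := by nlinarith [abs_nonneg m]
  obtain ⟨V, hVm, hVb, hV⟩ := hs.exists_transfer hy (q := fun x => Q x - m)
    (K := 2 * C * A.val (N + 1))
    (by rw [birkhoffSum_sub_const, ← hpdef, hm, mul_div_cancel₀ _ hp0, sub_self]) (by
      calc ∑ i ∈ Finset.range p, |Q (shift^[i] y) - m|
          ≤ ∑ i ∈ Finset.range p, (|Q (shift^[i] y)| + |m|) :=
            Finset.sum_le_sum fun i _ => abs_sub _ _
        _ = ∑ i ∈ Finset.range p, |Q (shift^[i] y)| + p * |m| := by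
            rw [Finset.sum_add_distrib, Finset.sum_const, Finset.card_range, nsmul_eq_mul]
        _ ≤ 2 * C * A.val (N + 1) := by linarith)
  let w : (ℕ → α) → ℝ := fun x => C * min (orbitDist A y x) (2 * A.val (N + 1))
  have hw0 : ∀ x, 0 ≤ w x := fun x =>
    mul_nonneg hC (le_min (orbitDist_nonneg _ _) (by linarith [A.pos (N + 1)]))
  have hw1 : ∀ x, w x ≤ 2 * C * A.val (N + 1) := fun x =>
    (mul_le_mul_of_nonneg_left (min_le_right _ _) hC).trans_eq (by ring)
  have hwm : Measurable w :=
    (((varLE_orbitDist y).continuous.measurable).min measurable_const).const_mul C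
  refine ⟨fun x => V x + w x, ε * A.val N - (1 + 7 * C) * A.val (N + 1), hVm.add hwm,
    ⟨4 * C * A.val (N + 1), fun x => ?_⟩, by linarith, fun x => ?_⟩
  · refine (abs_add_le _ _).trans ?_
    rw [abs_of_nonneg (hw0 x)]
    linarith [hVb x, hw1 x]
  by_cases hx : x ∈ orbitNhd (N + 1) y
  · rw [Set.indicator_of_notMem (by simpa using hx), mul_zero, sub_zero]
    have h1 := mul_le_mul_of_nonneg_left (hs.two_mul_orbitDist_le hA hx) hC
    obtain ⟨i, hi⟩ := hx
    have h2 : V x = birkhoffSum shift (fun x => Q x - m) i y := hV x i (hi.mono (Nat.le_succ N))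
    have h3 : V (shift x) = birkhoffSum shift (fun x => Q x - m) (i + 1) y :=
      hV _ _ (by rw [Function.iterate_succ_apply']; exact hi.shift)
    rw [birkhoffSum_succ, ← h2] at h3
    have h4 : |Q x - Q (shift^[i] y)| ≤ C * orbitDist A y x := by
      rw [hs.orbitDist_eq hi]
      unfold dA
      split_ifs with hxy
      · simp [hxy]
      · refine hvar _ (not_lt.1 fun hlt => PiNat.apply_firstDiff_ne hxy (hi _ hlt)) _ _ ?_
        exact fun j hj => PiNat.apply_eq_of_lt_firstDiff (E := fun _ => α) hj
    have h5 : w x ≤ C * orbitDist A y x := mul_le_mul_of_nonneg_left (min_le_left _ _) hC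
    have h6 := mul_nonneg hε (orbitDist_nonneg (A := A) y x)
    have h7 := (abs_le.1 h4).2
    have h8 : C * (2 * orbitDist A y x) ≤ w (shift x) := h1
    simp only
    linarith
  · rw [Set.indicator_of_mem (by simpa using hx), mul_one]
    have h1 := mul_le_mul_of_nonneg_left (le_orbitDist_of_notMem (A := A) hx) hε
    have h2 := (abs_le.1 (hVb x)).2
    have h3 := (abs_le.1 (hVb (shift x))).1
    have h4 := (abs_le.1 hm').1
    simp only
    linarith [hQ x, hw1 x, hw0 (shift x)]

/-! ### The orbit measure -/

theorem orbitMeasure_apply [MeasurableSpace α] (y : ℕ → α) {s : Set (ℕ → α)}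
    (hs : MeasurableSet s) :
    orbitMeasure y s = (Function.minimalPeriod shift y : ENNReal)⁻¹ *
      ∑ i ∈ Finset.range (Function.minimalPeriod shift y), s.indicator 1 (shift^[i] y) := by
  rw [orbitMeasure, Measure.smul_apply, Measure.finsetSum_apply, smul_eq_mul]
  simp only [Measure.dirac_apply' _ hs]

theorem measurable_shift [MeasurableSpace α] : Measurable (shift : (ℕ → α) → ℕ → α) :=
  measurable_pi_lambda _ fun n => measurable_pi_apply (n + 1)

theorem isInvariantProb_orbitMeasure [MeasurableSpace α] {y : ℕ → α}
    (hy : y ∈ Function.periodicPts (shift (α := α))) : IsInvariantProb (orbitMeasure y) := by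
  have hp := Function.minimalPeriod_pos_of_mem_periodicPts hy
  refine ⟨⟨?_⟩, measurable_shift, ?_⟩
  · rw [orbitMeasure_apply y .univ]
    simp only [Set.indicator_univ, Pi.one_apply, Finset.sum_const, Finset.card_range, nsmul_eq_mul,
      mul_one]
    exact ENNReal.inv_mul_cancel (by exact_mod_cast hp.ne') (by simp)
  · ext s hs
    rw [Measure.map_apply measurable_shift hs, orbitMeasure_apply y hs,
      orbitMeasure_apply y (measurable_shift hs)]
    congr 1
    have e : ∀ i, (shift ⁻¹' s).indicator (1 : (ℕ → α) → ENNReal) (shift^[i] y) =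
        s.indicator 1 (shift^[i + 1] y) := fun i => by
      rw [Function.iterate_succ_apply']
      rfl
    simp only [e]
    obtain ⟨k, hk⟩ := Nat.exists_eq_succ_of_ne_zero hp.ne'
    have hper : shift^[k + 1] y = y := by
      rw [← Nat.succ_eq_add_one, ← hk]
      exact Function.iterate_minimalPeriod
    rw [hk, Nat.succ_eq_add_one, Finset.sum_range_succ, hper, Finset.sum_range_succ']
    rfl

theorem integral_orbitMeasure [MeasurableSpace α] (y : ℕ → α) {g : (ℕ → α) → ℝ}
    (hg : Measurable g) :
    ∫ x, g x ∂(orbitMeasure y) = birkhoffSum shift g (Function.minimalPeriod shift y) y /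
      Function.minimalPeriod shift y := by
  rw [orbitMeasure, integral_smul_measure, integral_finsetSum_measure]
  · simp only [integral_dirac' _ _ hg.stronglyMeasurable]
    rw [birkhoffSum, div_eq_inv_mul, smul_eq_mul]
    simp
  · exact fun i _ => (integrable_dirac' hg.stronglyMeasurable (by simp))

/-- An invariant measure that lives on the cylinders of length `N + 1` around a periodic orbit with
distinct words of length `N` lives on the orbit itself, and is hence the orbit measure. -/
theorem Separated.eq_orbitMeasure [Finite α] [TopologicalSpace α] [DiscreteTopology α]
    [MeasurableSpace α] [BorelSpace α] {N : ℕ} {y : ℕ → α} (hs : Separated N y)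
    (hy : y ∈ Function.periodicPts (shift (α := α))) {ν : Measure (ℕ → α)}
    (hν : IsInvariantProb ν) (h : ν (orbitNhd (N + 1) y)ᶜ = 0) : ν = orbitMeasure y := by
  obtain ⟨hprob, hinv⟩ := hν
  have hp := Function.minimalPeriod_pos_of_mem_periodicPts hy
  set p := Function.minimalPeriod shift y with hpdef
  -- almost every point follows the orbit forever, hence belongs to it
  have hae : ∀ᵐ x ∂ν, ∃ i < p, x = shift^[i] y := by
    have h0 : ∀ᵐ x ∂ν, x ∈ orbitNhd (N + 1) y := h
    have h1 : ∀ᵐ x ∂ν, ∀ n, shift^[n] x ∈ orbitNhd (N + 1) y :=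
      ae_all_iff.2 fun n => (hinv.iterate n).quasiMeasurePreserving.ae h0
    filter_upwards [h1] with x hx
    obtain ⟨i, hi⟩ := hx 0
    have h2 : ∀ n, Agree (N + 1) (shift^[n] x) (shift^[n + i] y) := by
      intro n
      induction n with
      | zero => simpa using hi
      | succ n ih =>
        obtain ⟨j, hj⟩ := hx (n + 1)
        have h3 : Agree N (shift^[n + 1] x) (shift^[n + 1 + i] y) := by
          rw [Function.iterate_succ_apply', show n + 1 + i = (n + i) + 1 by ring,
            Function.iterate_succ_apply']
          exact ih.shift
        rwa [hs _ _ (h3.symm.trans (hj.mono (Nat.le_succ N)))]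
    refine ⟨i % p, Nat.mod_lt i hp, ?_⟩
    rw [Function.iterate_mod_minimalPeriod_eq]
    funext n
    have h4 := h2 n 0 (Nat.succ_pos N)
    rw [iterate_shift_apply, iterate_shift_apply] at h4
    rw [iterate_shift_apply]
    simpa [add_comm] using h4
  -- all points of the orbit have the same mass
  have hmass : ∀ i, ν {shift^[i] y} = ν {y} := by
    intro i
    induction i with
    | zero => rfl
    | succ i ih =>
      rw [← ih, ← hinv.measure_preimage (measurableSet_singleton _).nullMeasurableSet]
      refine measure_congr ?_
      filter_upwards [hae] with x hx
      obtain ⟨j, -, rfl⟩ := hx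
      refine propext ⟨fun hj => ?_, fun hj => ?_⟩
      · have h5 : shift (shift^[j] y) = shift (shift^[i] y) := by
          rw [← Function.iterate_succ_apply' shift i]
          exact hj
        have h6 := congrArg (shift^[p - 1]) h5
        simp only [← Function.iterate_succ_apply] at h6
        rw [Nat.succ_eq_add_one, Nat.sub_add_cancel hp, ← Function.iterate_add_apply,
          ← Function.iterate_add_apply, add_comm p j, add_comm p i, Function.iterate_add_apply,
          Function.iterate_add_apply, Function.iterate_minimalPeriod] at h6
        exact h6
      · have hj' : shift^[j] y = shift^[i] y := hj
        show shift (shift^[j] y) = shift^[i + 1] y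
        rw [Function.iterate_succ_apply', hj']
  have hform : ∀ s, MeasurableSet s → ν s =
      ν {y} * ∑ i ∈ Finset.range p, s.indicator 1 (shift^[i] y) := by
    intro s hsm
    have hinj : Set.PairwiseDisjoint (Finset.range p : Set ℕ)
        fun i => s ∩ {shift^[i] y} := by
      intro i hi j hj hij
      refine (Set.disjoint_singleton.2 fun he => hij ?_).mono Set.inter_subset_right
        Set.inter_subset_right
      exact Function.iterate_injOn_Iio_minimalPeriod (by simpa using hi) (by simpa using hj) he
    have h7 : ν s = ν (⋃ i ∈ Finset.range p, s ∩ {shift^[i] y}) := by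
      refine measure_congr ?_
      filter_upwards [hae] with x hx
      obtain ⟨i, hi, hxi⟩ := hx
      refine propext ⟨fun hxs => ?_, fun hxs => ?_⟩
      · exact Set.mem_biUnion (Finset.mem_coe.2 (Finset.mem_range.2 hi)) ⟨hxs, hxi⟩
      · obtain ⟨j, -, hj⟩ := Set.mem_iUnion₂.1 hxs
        exact hj.1
    rw [h7, measure_biUnion_finset hinj
      fun i _ => hsm.inter (measurableSet_singleton _), Finset.mul_sum]
    refine Finset.sum_congr rfl fun i _ => ?_
    by_cases hi : shift^[i] y ∈ s
    · rw [Set.inter_eq_self_of_subset_right (Set.singleton_subset_iff.2 hi), hmass]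
      simp [hi]
    · rw [Set.inter_singleton_eq_empty.2 hi]
      simp [hi]
  have hone := hform Set.univ .univ
  rw [measure_univ] at hone
  simp only [Set.indicator_univ, Pi.one_apply, Finset.sum_const, Finset.card_range, nsmul_eq_mul,
    mul_one] at hone
  ext s hsm
  rw [orbitMeasure_apply y hsm, hform s hsm, ENNReal.eq_inv_of_mul_eq_one_left hone.symm]

/-- If a function is, up to a bounded coboundary, at most a constant `m`, and smaller by a definite
amount outside a set, then its integrals against invariant measures are at most `m`, with equality
only for measures carried by that set. -/
theorem integral_le_of_cohomologous_le [MeasurableSpace α] {ν : Measure (ℕ → α)}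
    (hν : IsInvariantProb ν) {g v : (ℕ → α) → ℝ} {m c : ℝ} {E : Set (ℕ → α)} (hg : Measurable g)
    (hgb : ∃ B, ∀ x, |g x| ≤ B) (hv : Measurable v) (hvb : ∃ B, ∀ x, |v x| ≤ B) (hc : 0 < c)
    (hE : MeasurableSet E)
    (h : ∀ x, g x + v x - v (shift x) ≤ m - c * Eᶜ.indicator (fun _ => 1) x) :
    ∫ x, g x ∂ν ≤ m ∧ (m ≤ ∫ x, g x ∂ν → ν Eᶜ = 0) := by
  obtain ⟨hprob, hinv⟩ := hν
  obtain ⟨B, hB⟩ := hgb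
  obtain ⟨B', hB'⟩ := hvb
  have ig : Integrable g ν := .of_bound hg.aestronglyMeasurable B (ae_of_all _ hB)
  have iv : Integrable v ν := .of_bound hv.aestronglyMeasurable B' (ae_of_all _ hB')
  have iv' : Integrable (fun x => v (shift x)) ν := hinv.integrable_comp_of_integrable iv
  have iE : Integrable (Eᶜ.indicator fun _ => (1 : ℝ)) ν :=
    (integrable_const 1).indicator hE.compl
  have ev : ∫ x, v (shift x) ∂ν = ∫ x, v x ∂ν := by
    rw [← integral_map measurable_shift.aemeasurable (by
      rw [hinv.map_eq]; exact hv.aestronglyMeasurable), hinv.map_eq]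
  have key : ∫ x, g x ∂ν ≤ m - c * ν.real Eᶜ := by
    have h1 := integral_mono ((ig.add iv).sub iv') ((integrable_const m).sub (iE.const_mul c)) h
    have e1 : ∫ x, (g x + v x - v (shift x)) ∂ν = ∫ x, g x ∂ν := by
      rw [integral_sub (f := fun x => g x + v x) (ig.add iv) iv', integral_add ig iv, ev]
      ring
    have e2 : ∫ x, (m - c * Eᶜ.indicator (fun _ => (1 : ℝ)) x) ∂ν = m - c * ν.real Eᶜ := by
      rw [integral_sub (integrable_const m) (iE.const_mul c), integral_const_mul,
        integral_indicator_const _ hE.compl]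
      simp
    calc ∫ x, g x ∂ν = _ := e1.symm
      _ ≤ _ := h1
      _ = _ := e2
  have h0 : 0 ≤ ν.real Eᶜ := measureReal_nonneg
  refine ⟨by nlinarith, fun hm => ?_⟩
  have h2 : ν.real Eᶜ = 0 := by nlinarith
  exact (measureReal_eq_zero_iff).1 h2

/-! ### The Banach space of Lipschitz functions -/

namespace CA

theorem abs_le_norm (f : CA α A) (x : ℕ → α) : |f.toFun x| ≤ ‖f‖ :=
  (f.isLipA.abs_le_supNorm x).trans (le_add_of_nonneg_left lipConst_nonneg)

theorem lipConst_le_norm (f : CA α A) : lipConst A f.toFun ≤ ‖f‖ :=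
  le_add_of_nonneg_right supNorm_nonneg

theorem toFun_sub_apply (f g : CA α A) (x : ℕ → α) :
    (f - g).toFun x = f.toFun x - g.toFun x := rfl

theorem varLE_norm (f : CA α A) : VarLE A ‖f‖ f.toFun :=
  f.isLipA.varLE.mono f.lipConst_le_norm

theorem norm_le {f : CA α A} {b c : ℝ} (hb : 0 ≤ b) (hc : 0 ≤ c) (h : ∀ x, |f.toFun x| ≤ b)
    (h' : VarLE A c f.toFun) : ‖f‖ ≤ c + b :=
  add_le_add (lipConst_le hc h') (Real.iSup_le h hb)

theorem completeSpace : CompleteSpace (CA α A) := by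
  refine Metric.complete_of_cauchySeq_tendsto fun s hs => ?_
  have hpt : ∀ x, ∃ t, Tendsto (fun n => (s n).toFun x) atTop (𝓝 t) := by
    intro x
    refine cauchySeq_tendsto_of_complete (Metric.cauchySeq_iff.2 fun ε hε => ?_)
    obtain ⟨N, hN⟩ := Metric.cauchySeq_iff.1 hs ε hε
    refine ⟨N, fun m hm n hn => ?_⟩
    rw [Real.dist_eq, ← toFun_sub_apply]
    exact (abs_le_norm _ x).trans_lt (by rw [← dist_eq_norm]; exact hN m hm n hn)
  choose F hF using hpt
  have key : ∀ ε > 0, ∃ N, ∀ n ≥ N, (∀ x, |(s n).toFun x - F x| ≤ ε) ∧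
      VarLE A ε fun x => (s n).toFun x - F x := by
    intro ε hε
    obtain ⟨N, hN⟩ := Metric.cauchySeq_iff.1 hs ε hε
    have hle : ∀ n ≥ N, ∀ m ≥ N, ‖s n - s m‖ ≤ ε := fun n hn m hm => by
      rw [← dist_eq_norm]
      exact (hN n hn m hm).le
    refine ⟨N, fun n hn => ⟨fun x => ?_, fun k x y hxy => ?_⟩⟩
    · refine le_of_tendsto ((tendsto_const_nhds.sub (hF x)).abs) ?_
      filter_upwards [eventually_ge_atTop N] with m hm
      exact (abs_le_norm (s n - s m) x).trans (hle n hn m hm)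
    · refine le_of_tendsto (((tendsto_const_nhds.sub (hF x)).sub
        (tendsto_const_nhds.sub (hF y))).abs) ?_
      filter_upwards [eventually_ge_atTop N] with m hm
      exact ((s n - s m).varLE_norm.mono (hle n hn m hm)) k x y hxy
  have hlip : IsLipA A F := by
    obtain ⟨N, hN⟩ := key 1 one_pos
    have h := ((s N).isLipA).add ((hN N le_rfl).2.isLipA.smul (-1))
    convert h using 1
    funext x
    simp
  obtain ⟨G, rfl⟩ : ∃ G : CA α A, G.toFun = F := ⟨⟨F, hlip⟩, rfl⟩
  refine ⟨G, Metric.tendsto_atTop.2 fun ε hε => ?_⟩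
  obtain ⟨N, hN⟩ := key (ε / 3) (by positivity)
  refine ⟨N, fun n hn => ?_⟩
  rw [dist_eq_norm]
  have := norm_le (f := s n - G) (b := ε / 3) (c := ε / 3) (by positivity) (by positivity)
    (hN n hn).1 (hN n hn).2
  linarith

end CA

/-- The place of the first difference from `z` is decided by the first `k` symbols, if it is among
them. -/
theorem firstDiff_eq_of_agree {k : ℕ} {x x' z : ℕ → α} (h : Agree k x x') (hz : ¬ Agree k x z) :
    PiNat.firstDiff x z = PiNat.firstDiff x' z := by
  have hz' : ¬ Agree k x' z := fun hx' => hz (h.trans hx')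
  have key : ∀ {x : ℕ → α}, ¬ Agree k x z → x (PiNat.firstDiff x z) ≠ z (PiNat.firstDiff x z) ∧
      PiNat.firstDiff x z < k := by
    intro x hx
    refine ⟨PiNat.apply_firstDiff_ne fun he => hx fun i _ => congrFun he i, not_le.1 fun hk => ?_⟩
    exact hx fun i hi => PiNat.apply_eq_of_lt_firstDiff (E := fun _ => α) (by omega)
  obtain ⟨h1, h2⟩ := key hz
  obtain ⟨h3, h4⟩ := key hz'
  rcases lt_trichotomy (PiNat.firstDiff x z) (PiNat.firstDiff x' z) with hlt | he | hlt
  · exact absurd ((h _ h2).trans (PiNat.apply_eq_of_lt_firstDiff (E := fun _ => α) hlt)) h1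
  · exact he
  · exact absurd ((h _ h4).symm.trans (PiNat.apply_eq_of_lt_firstDiff (E := fun _ => α) hlt)) h3

open Classical in
/-- The distance to the fixed point `a a a ⋯`, kept only at those `x` whose first symbol different
from `a` is at a place in `S`, and replaced by `0` elsewhere. At the fixed point itself
`PiNat.firstDiff` takes a junk value, but both branches are `0` there. -/
noncomputable def shellDist (A : ASequence) (a : α) (S : Set ℕ) (x : ℕ → α) : ℝ :=
  if PiNat.firstDiff x (fun _ => a) ∈ S then dA A x fun _ => a else 0

theorem varLE_shellDist (a : α) (S : Set ℕ) : VarLE A 1 (shellDist A a S) := by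
  intro k x x' h
  rw [one_mul]
  by_cases hx : Agree k x fun _ => a
  · have key : ∀ z : ℕ → α, Agree k z (fun _ => a) →
        0 ≤ shellDist A a S z ∧ shellDist A a S z ≤ A.val k := by
      intro z hz
      unfold shellDist
      split_ifs
      · exact ⟨dA_nonneg _ _, dA_le hz⟩
      · exact ⟨le_rfl, (A.pos k).le⟩
    obtain ⟨h1, h2⟩ := key x hx
    obtain ⟨h3, h4⟩ := key x' (h.symm.trans hx)
    rw [abs_le]
    constructor <;> linarith
  · have hx' : ¬ Agree k x' fun _ => a := fun hx' => hx (h.trans hx')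
    have e := firstDiff_eq_of_agree h hx
    have n1 : x ≠ fun _ => a := fun he => hx fun i _ => congrFun he i
    have n2 : x' ≠ fun _ => a := fun he => hx' fun i _ => congrFun he i
    unfold shellDist dA
    rw [if_neg n1, if_neg n2, e, sub_self, abs_zero]
    exact (A.pos k).le

/-- The uncountably many functions `shellDist A a S`, for sets `S` of natural numbers, are at mutual
distance at least `1`. -/
theorem not_separableSpace_CA [Nontrivial α] :
    ¬ TopologicalSpace.SeparableSpace (CA α A) := by
  intro hsep
  obtain ⟨a, b, hab⟩ := exists_pair_ne α
  let f : Set ℕ → CA α A := fun S => ⟨shellDist A a S, (varLE_shellDist a S).isLipA⟩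
  have hval : ∀ n : ℕ, ∃ x : ℕ → α, Agree n x (fun _ => a) ∧ ∀ S : Set ℕ,
      (n ∈ S → shellDist A a S x = A.val n) ∧ (n ∉ S → shellDist A a S x = 0) := by
    intro n
    set x : ℕ → α := fun i => if i < n then a else b with hx
    have hag : Agree n x fun _ => a := fun i hi => if_pos hi
    have hxn : x n = b := if_neg (lt_irrefl n)
    have hne : x ≠ fun _ => a := fun he => hab ((congrFun he n).symm.trans hxn)
    have hfd : PiNat.firstDiff x (fun _ => a) = n := by
      refine le_antisymm (not_lt.1 fun hlt => ?_) (not_lt.1 fun hlt => ?_)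
      · have := PiNat.apply_eq_of_lt_firstDiff (E := fun _ => α) hlt
        exact hab (this.symm.trans hxn)
      · exact PiNat.apply_firstDiff_ne hne (hag _ hlt)
    refine ⟨x, hag, fun S => ⟨fun hS => ?_, fun hS => ?_⟩⟩
    · unfold shellDist dA
      rw [hfd, if_pos hS, if_neg hne]
    · unfold shellDist
      rw [hfd, if_neg hS]
  have hbase : ∀ S, shellDist A a S (fun _ => a) = 0 := fun S => by
    unfold shellDist
    rw [dA_self, ite_self]
  have hfar : ∀ (S S' : Set ℕ) (n : ℕ), n ∈ S → n ∉ S' → 1 ≤ ‖f S - f S'‖ := by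
    intro S S' n hS hS'
    obtain ⟨x, hag, hx⟩ := hval n
    have h1 := (f S - f S').varLE_norm n x _ hag
    have h2 : (f S - f S').toFun x = A.val n := by
      rw [CA.toFun_sub_apply]
      show shellDist A a S x - shellDist A a S' x = _
      rw [(hx S).1 hS, (hx S').2 hS', sub_zero]
    have h3 : (f S - f S').toFun (fun _ => a) = 0 := by
      rw [CA.toFun_sub_apply]
      show shellDist A a S _ - shellDist A a S' _ = _
      rw [hbase, hbase, sub_zero]
    rw [h2, h3, sub_zero, abs_of_pos (A.pos n)] at h1
    exact le_of_mul_le_mul_right (by simpa using h1) (A.pos n)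
  have hdist : ∀ S S', S ≠ S' → 1 ≤ dist (f S) (f S') := by
    intro S S' hne
    have : ∃ n, ¬ (n ∈ S ↔ n ∈ S') := by
      by_contra! hcon
      exact hne (Set.ext hcon)
    obtain ⟨n, hn⟩ := this
    by_cases hS : n ∈ S
    · rw [dist_eq_norm]
      exact hfar S S' n hS fun h => hn ⟨fun _ => h, fun _ => hS⟩
    · rw [dist_comm, dist_eq_norm]
      exact hfar S' S n (by tauto) hS
  have hcount : (Set.univ : Set (Set ℕ)).Countable := by
    refine Set.PairwiseDisjoint.countable_of_isOpen (s := fun S => Metric.ball (f S) (1 / 2))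
      (fun S _ S' _ hne => ?_) (fun _ _ => Metric.isOpen_ball)
      fun S _ => ⟨f S, Metric.mem_ball_self (by norm_num)⟩
    refine Metric.ball_disjoint_ball ?_
    have := hdist S S' hne
    norm_num
    exact this
  have : Countable (Set ℕ) := Set.countable_univ_iff.1 hcount
  obtain ⟨g, hg⟩ := exists_injective_nat (Set ℕ)
  exact Function.cantor_injective g hg

/-! ### Density of the locking functions -/

/-- Subtracting `ε` times the distance to a suitable periodic orbit locks the maximizing measure
onto that orbit. -/
theorem exists_mem_interior_P [Finite α] [Nonempty α] [TopologicalSpace α] [DiscreteTopology α]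
    [MeasurableSpace α] [BorelSpace α]
    (hA : Tendsto (fun n => A.val (n + 1) / A.val n) atTop (𝓝 0)) (f : CA α A) {r : ℝ}
    (hr : 0 < r) :
    ∃ y ∈ Function.periodicPts (shift (α := α)), ∃ g ∈ Metric.ball f r, g ∈ interior (P A y) := by
  obtain ⟨C₀, hC₀, hsumA⟩ := exists_sum_le hA
  set L := ‖f‖ with hL
  have hL0 : 0 ≤ L := norm_nonneg f
  obtain ⟨u, hu, huv⟩ := exists_subaction hL0 f.varLE_norm hsumA
  have huVar : VarLE A (L * C₀) u := fun k x y h => (huv k x y h).trans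
    (mul_le_mul_of_nonneg_left (A.anti (Nat.le_succ k)) (by positivity))
  set b := sSup (periodicMeans f.toFun) with hb
  set F : (ℕ → α) → ℝ := fun x => f.toFun x - b + u x - u (shift x) with hFdef
  set c := L * (1 + 2 * C₀) with hc
  have hc0 : 0 ≤ c := by positivity
  have hF : ∀ k, 1 ≤ k → ∀ x y : ℕ → α, Agree k x y → |F x - F y| ≤ c * A.val k := by
    intro k hk x y hxy
    obtain ⟨l, rfl⟩ := Nat.exists_eq_add_of_le' hk
    have e : F x - F y = (f.toFun x - f.toFun y) + (u x - u y) -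
        (u (shift x) - u (shift y)) := by
      simp only [hFdef]; ring
    have h1 := abs_le.1 (f.varLE_norm _ x y hxy)
    have h2 := abs_le.1 (huVar _ x y hxy)
    have h3 := abs_le.1 (huv _ _ _ hxy.shift)
    rw [← hL] at h1
    have e' : c * A.val (l + 1) = L * A.val (l + 1) + L * C₀ * A.val (l + 1) +
      L * C₀ * A.val (l + 1) := by rw [hc]; ring
    rw [e, e', abs_le]
    constructor <;> linarith
  -- `C` bounds both the variation of `F + h` and its sum over the orbit `O(y)` found below, for
  -- every perturbation `h` that is small enough in terms of `y`.
  set C := c * C₀ + c + A.val 0 + 2 with hC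
  have hA0 := A.pos 0
  have hcC₀ : 0 ≤ c * C₀ := by positivity
  set ε := r / (2 * (1 + A.val 0)) with hε
  have hε0 : 0 < ε := by positivity
  have hC0 : 0 < 1 + 7 * C := by positivity
  obtain ⟨N, hN⟩ := eventually_atTop.1 ((hA.eventually_lt_const (show (0 : ℝ) < 1 / 2 by
    norm_num)).and (hA.eventually_lt_const (div_pos hε0 hC0)))
  have hhalf : ∀ k, N ≤ k → 2 * A.val (k + 1) ≤ A.val k := fun k hk => by
    have := (div_lt_iff₀ (A.pos k)).1 (hN k hk).1
    linarith
  have hgap : (1 + 7 * C) * A.val (N + 1) < ε * A.val N := by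
    have := (hN N le_rfl).2
    rw [div_lt_div_iff₀ (A.pos N) hC0] at this
    linarith
  obtain ⟨y, hy, hs, hyF⟩ := exists_periodic_orbit hc0 hsumA hu hF N
  have hs : Separated N y := hs
  refine ⟨y, hy, ?_⟩
  have hp := Function.minimalPeriod_pos_of_mem_periodicPts hy
  set p := Function.minimalPeriod shift y with hpdef
  have hp1 : (1 : ℝ) ≤ p := by exact_mod_cast hp
  have hp0 : (0 : ℝ) < p := by linarith
  let D : CA α A := ⟨orbitDist A y, (varLE_orbitDist y).isLipA⟩
  have hD : ‖D‖ ≤ 1 + A.val 0 := by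
    refine CA.norm_le hA0.le zero_le_one (fun x => ?_) (varLE_orbitDist y)
    show |orbitDist A y x| ≤ _
    rw [abs_of_nonneg (orbitDist_nonneg y x)]
    exact orbitDist_le_val_zero y x
  refine ⟨f - ε • D, ?_, ?_⟩
  · rw [Metric.mem_ball, dist_eq_norm, sub_sub_cancel_left, norm_neg, norm_smul, Real.norm_eq_abs,
      abs_of_pos hε0]
    have h1 := mul_le_mul_of_nonneg_left hD hε0.le
    have h2 : ε * (1 + A.val 0) = r / 2 := by rw [hε]; field_simp
    linarith
  rw [mem_interior_iff_mem_nhds, Metric.mem_nhds_iff]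
  refine ⟨A.val (N + 1) / p, div_pos (A.pos _) hp0, fun g hg => ?_⟩
  set h : CA α A := g - (f - ε • D) with hh
  have hnorm : p * ‖h‖ ≤ A.val (N + 1) := by
    rw [Metric.mem_ball, dist_eq_norm, lt_div_iff₀ hp0] at hg
    linarith
  have hnorm' : ‖h‖ ≤ A.val (N + 1) := by nlinarith [norm_nonneg h]
  have hnorm0 : ‖h‖ ≤ A.val 0 := hnorm'.trans (A.anti (Nat.zero_le _))
  have hgx : ∀ x, g.toFun x = f.toFun x - ε * orbitDist A y x + h.toFun x := by
    intro x
    have : h.toFun x = g.toFun x - (f.toFun x - ε * orbitDist A y x) := rfl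
    rw [this]; ring
  have hFneg : ∀ x, F x ≤ 0 := hu
  let Q : (ℕ → α) → ℝ := fun x => F x + h.toFun x
  have hQ : ∀ x, Q x ≤ A.val (N + 1) := fun x => by
    have := (abs_le.1 (h.abs_le_norm x)).2
    simp only [Q]
    linarith [hFneg x]
  have hQvar : ∀ k, N + 1 ≤ k → ∀ x z : ℕ → α, Agree k x z → |Q x - Q z| ≤ C * A.val k := by
    intro k hk x z hxz
    have h1 := hF k (by omega) x z hxz
    have h2 := h.varLE_norm.mono hnorm0 k x z hxz
    have e : Q x - Q z = (F x - F z) + (h.toFun x - h.toFun z) := by simp only [Q]; ring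
    rw [e]
    refine (abs_add_le _ _).trans ((add_le_add h1 h2).trans ?_)
    rw [← add_mul]
    exact mul_le_mul_of_nonneg_right (by linarith) (A.pos k).le
  have hQsum : ∑ i ∈ Finset.range p, |Q (shift^[i] y)| ≤ C * A.val (N + 1) := by
    calc ∑ i ∈ Finset.range p, |Q (shift^[i] y)|
        ≤ ∑ i ∈ Finset.range p, (-F (shift^[i] y) + ‖h‖) := by
          refine Finset.sum_le_sum fun i _ => (abs_add_le _ _).trans ?_
          exact add_le_add (abs_of_nonpos (hFneg _)).le (h.abs_le_norm _)
      _ = -birkhoffSum shift F p y + p * ‖h‖ := by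
          rw [Finset.sum_add_distrib, Finset.sum_neg_distrib, Finset.sum_const, Finset.card_range,
            nsmul_eq_mul, birkhoffSum]
      _ ≤ (c * C₀ + 1) * A.val (N + 1) + A.val (N + 1) := by linarith
      _ ≤ C * A.val (N + 1) := by nlinarith [A.pos (N + 1)]
  obtain ⟨v, c', hvm, ⟨B, hB⟩, hc', hv⟩ :=
    hs.exists_cohomologous_le hy hhalf (by positivity) hε0.le hQ hQvar hQsum hgap
  set m := birkhoffSum shift Q p y / p with hm
  have hgm : Measurable g.toFun := g.varLE_norm.continuous.measurable
  have hum : Measurable u := huVar.continuous.measurable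
  obtain ⟨B', hB'⟩ := huVar.bounded
  have hmain : ∀ ν, IsInvariantProb ν → ∫ x, g.toFun x ∂ν ≤ m + b ∧
      (m + b ≤ ∫ x, g.toFun x ∂ν → ν (orbitNhd (N + 1) y)ᶜ = 0) := by
    intro ν hν
    refine integral_le_of_cohomologous_le hν (v := fun x => u x + v x) hgm ⟨_, g.abs_le_norm⟩
      (hum.add hvm) ⟨B' + B, fun x => (abs_add_le _ _).trans (add_le_add (hB' x) (hB x))⟩ hc'
      (isOpen_orbitNhd _ y).measurableSet fun x => ?_
    have h1 := hv x
    rw [hgx]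
    simp only [Q, hFdef] at h1 ⊢
    linarith
  have horb : ∫ x, g.toFun x ∂(orbitMeasure y) = m + b := by
    rw [integral_orbitMeasure y hgm, ← hpdef, hm, div_add' _ _ _ hp0.ne']
    congr 1
    have h1 := birkhoffSum_coboundary u p y
    rw [hpdef, Function.iterate_minimalPeriod, sub_self, ← hpdef] at h1
    have h2 : birkhoffSum shift g.toFun p y = birkhoffSum shift
        (fun x => Q x - -b) p y - birkhoffSum shift (fun z => u z - u (shift z)) p y := by
      unfold birkhoffSum
      rw [← Finset.sum_sub_distrib]
      refine Finset.sum_congr rfl fun i _ => ?_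
      rw [hgx, orbitDist_iterate]
      simp only [Q, hFdef]
      ring
    rw [h2, h1, birkhoffSum_sub_const]
    ring
  have hinv := isInvariantProb_orbitMeasure hy
  refine ⟨⟨hinv, fun ν hν => ?_⟩, fun ν hν => ?_⟩
  · rw [horb]
    exact (hmain ν hν).1
  · refine hs.eq_orbitMeasure hy hν.1 ((hmain ν hν.1).2 ?_)
    rw [← horb]
    exact hν.2 _ hinv

end SuperCont

theorem theorem1 {α : Type*} [Finite α] [Nonempty α] [TopologicalSpace α] [DiscreteTopology α]
    [MeasurableSpace α] [BorelSpace α] (A : SuperCont.ASequence)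
    (hA : Tendsto (fun n => A.val (n + 1) / A.val n) atTop (𝓝 0)) :
    CompleteSpace (SuperCont.CA α A) ∧
    (Nontrivial α → ¬ TopologicalSpace.SeparableSpace (SuperCont.CA α A)) ∧
    Dense (⋃ y ∈ Function.periodicPts (SuperCont.shift (α := α)),
      interior (SuperCont.P A y)) := by
  refine ⟨SuperCont.CA.completeSpace, fun _ => SuperCont.not_separableSpace_CA,
    Metric.dense_iff.2 fun f r hr => ?_⟩
  obtain ⟨y, hy, g, hg, hgi⟩ := SuperCont.exists_mem_interior_P hA f hr
  exact ⟨g, hg, Set.mem_biUnion hy hgi⟩
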